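/- Let $\mathbb{D}=\{z\in\mathbb{C}:|z|<1\}$, let $d(z)$ be the Euclidean distance from $z\in\mathbb D$ to $\partial\mathbb{D}$, and let $\sigma$ be the area measure on $\mathbb{D}$ normalized so that $\sigma(\mathbb{D})=1$. For a real-differentiable function $f:\mathbb{D}\to\mathbb{C}$ let $\|D_f(z)\|=|f_z(z)|+|f_{\bar z}(z)|$ denote the operator norm of its real derivative at $z$. For $\gamma,\mu>0$, let $\mathcal{D}_{\gamma,\mu}(\mathbb{D})$ be the set of all $f\in\mathcal{C}^1(\mathbb{D})$ (complex-valued) with $$|f(0)|+\int_{\mathbb{D}}d(z)^{\gamma}\,\|D_f(z)\|^{\mu}\,d\sigma(z)<\infty .$$ For $0<p<\infty$, let $H^p_g(\mathbb{D})$ be the set of all measurable $f:\mathbb{D}\to\mathbb{C}$ such that the integral mean $$M_p(r,f)=\Big(\frac1{2\pi}\int_0^{2\pi}|f(re^{i\theta})|^p\,d\theta\Big)^{1/p}$$ exists (as a finite number) for every $r\in(0,1)$ and $\sup_{0<r<1}M_p(r,f)<\infty$. Let $0<\gamma\le 1$, let $\lambda\ge 0$ be a real constant, and let $f\in\mathcal{C}^2(\mathbb{D})\cap\mathcal{D}_{\gamma,2}(\mathbb{D})$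 satisfy $\Delta f=\lambda f$ in $\mathbb{D}$, where $\Delta=\partial_x^2+\partial_y^2$. Then $f\in H_g^{2/\gamma}(\mathbb{D})$. -/

import Mathlib

open scoped ENNReal InnerProductSpace

noncomputable section

namespace DiskSpaces

/-- The open unit disk. -/
def disk : Set ℂ := Metric.ball 0 1

/-- Euclidean distance to the boundary of the unit disk. -/
def bdist (z : ℂ) : ℝ := Metric.infDist z (frontier disk)

/-- Normalized area measure on the unit disk (total mass one). -/
def areaMeasure : MeasureTheory.Measure ℂ :=
  (MeasureTheory.volume disk)⁻¹ • MeasureTheory.volume.restrict disk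

/-- The Dirichlet-type norm `|f(0)| + ∫ d(z)^γ ‖D_f(z)‖^μ dσ(z)`, with values in `[0, ∞]`.
Here `D_f` is the real derivative of `f` with its operator norm for the Euclidean norm on `ℂ`. -/
def dirichletNorm (γ μ : ℝ) (f : ℂ → ℂ) : ℝ≥0∞ :=
  ‖f 0‖ₑ + ∫⁻ z, ENNReal.ofReal (bdist z ^ γ * ‖fderiv ℝ f z‖ ^ μ) ∂areaMeasure

/-- Membership in the Dirichlet-type space with parameters `γ, μ > 0`. Only the values of `f` on
the disk matter. -/
structure MemDirichlet (γ μ : ℝ) (f : ℂ → ℂ) : Prop where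
  contDiffOn : ContDiffOn ℝ 1 f disk
  norm_lt_top : dirichletNorm γ μ f < ∞

/-- The integral mean `M_p(r, f) = ((2π)⁻¹ ∫_0^{2π} |f(r e^{iθ})|^p dθ)^{1/p}` for finite `p`. -/
def integralMean (p r : ℝ) (f : ℂ → ℂ) : ℝ :=
  (Real.circleAverage (fun z => ‖f z‖ ^ p) 0 r) ^ (1 / p)

/-- The generalized Hardy norm, with values in `[0, ∞]`. -/
def hardyNorm (p : ℝ≥0∞) (f : ℂ → ℂ) : ℝ≥0∞ :=
  if p = ∞ then ⨆ z ∈ disk, ‖f z‖ₑ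
  else ⨆ r ∈ Set.Ioo (0 : ℝ) 1, ENNReal.ofReal (integralMean p.toReal r f)

/-- Membership in the generalized Hardy space with exponent `p ∈ (0, ∞]`: `f` is measurable on
the disk, the integral means exist, and the norm is finite. -/
structure MemHardy (p : ℝ≥0∞) (f : ℂ → ℂ) : Prop where
  measurable : Measurable (fun z : disk => f z)
  mean_exists : p ≠ ∞ → ∀ r ∈ Set.Ioo (0 : ℝ) 1,
    CircleIntegrable (fun z => ‖f z‖ ^ p.toReal) 0 r
  norm_lt_top : hardyNorm p f < ∞

end DiskSpaces

end

/-!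
Put `w = |f|² + 1` and `q = 1/γ ≥ 1`. The function `g = w^q` is `C²` and dominates `|f|^(2/γ)`, so it
suffices to bound the circle averages of `g`. Adding `1` keeps `w` away from zero, so that no
regularization at the zeros of `f` is needed.

Since `Δf = λf` with `λ ≥ 0`, the function `g` is subharmonic, with
`0 ≤ Δg ≤ 8 q² w^(q-1) ‖Df‖² + 2 q λ w^q` (`laplacian_rpow_norm_sq_add_one_le`). By Green's identity
in the differentiated form `hasDerivAt_flux`, the circle averages of a subharmonic function stay
bounded if `∫ (1 - |z|) Δg` is finite (`exists_circleAverage_le_of_laplacian_le`).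

The finiteness follows from a growth estimate. Directional derivatives of `f` satisfy the sub-mean
value inequality (`norm_fderiv_apply_sq_le_circleAverage`). Integrating it over the disk about `z`
of radius `(1 - |z|)/2` gives `‖Df(z)‖² ≤ C (1 - |z|)^(-2-γ)`, and integrating this along radii gives
`w ≤ C (1 - |z|)^(-γ)` (`exists_norm_sq_add_one_le`). Hence `w^(q-1) ≤ C (1 - |z|)^(γ-1)` and
`w^q ≤ C (1 - |z|)^(-1)`, so that `(1 - |z|) Δg ≤ C (1 - |z|)^γ ‖Df‖² + C`, which is integrable.
-/

open MeasureTheory Real Complex Set Metric Filter Topology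

/-! ### Circle averages of smooth functions -/

/-- Differentiation under the integral sign over a compact interval, for a continuous derivative. -/
lemma intervalIntegral.hasDerivAt_integral_of_continuousOn_deriv {F F' : ℝ → ℝ → ℝ} {U : Set ℝ}
    (hU : IsOpen U) {x₀ : ℝ} (hx₀ : x₀ ∈ U) (a b : ℝ) (hF : ∀ x ∈ U, Continuous (F x))
    (hF' : ContinuousOn (fun p : ℝ × ℝ => F' p.1 p.2) (U ×ˢ univ))
    (h : ∀ x ∈ U, ∀ t, HasDerivAt (fun y => F y t) (F' x t) x) :
    HasDerivAt (fun x => ∫ t in a..b, F x t) (∫ t in a..b, F' x₀ t) x₀ := by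
  obtain ⟨ε, hε, hεU⟩ := Metric.nhds_basis_closedBall.mem_iff.1 (hU.mem_nhds hx₀)
  have hK : IsCompact (closedBall x₀ ε ×ˢ uIcc a b) :=
    (isCompact_closedBall _ _).prod isCompact_uIcc
  obtain ⟨M, hM⟩ := hK.exists_bound_of_continuousOn
    (hF'.mono (prod_mono hεU (subset_univ _)))
  have hc : Continuous (F' x₀) := by
    have : ContinuousOn (fun t : ℝ => F' x₀ t) univ :=
      hF'.comp (f := fun t : ℝ => (x₀, t)) (by fun_prop) (fun t _ => ⟨hx₀, mem_univ _⟩)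
    exact continuousOn_univ.1 this
  refine (intervalIntegral.hasDerivAt_integral_of_dominated_loc_of_deriv_le
    (F := F) (F' := F') (bound := fun _ => M)
    (closedBall_mem_nhds x₀ hε) ?_ ((hF x₀ hx₀).intervalIntegrable _ _)
    hc.aestronglyMeasurable ?_ (by simp) ?_).2
  · filter_upwards [hU.mem_nhds hx₀] with x hx
    exact (hF x hx).aestronglyMeasurable
  · exact Eventually.of_forall fun t ht x hx => hM (x, t) ⟨hx, uIoc_subset_uIcc ht⟩
  · exact Eventually.of_forall fun t _ x hx => h x (hεU hx) t

lemma circleMap_mem_ball_of_abs_lt {c : ℂ} {R r : ℝ} (hr : |r| < R) (θ : ℝ) :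
    circleMap c r θ ∈ ball c R := by
  simpa [mem_ball, dist_eq_norm, circleMap] using hr

lemma ContinuousOn.continuous_comp_circleMap {E : Type*} [TopologicalSpace E] {h : ℂ → E}
    {c : ℂ} {R r : ℝ} (hh : ContinuousOn h (ball c R)) (hr : |r| < R) :
    Continuous fun θ => h (circleMap c r θ) :=
  hh.comp_continuous (continuous_circleMap c r) (circleMap_mem_ball_of_abs_lt hr)

lemma ContinuousOn.circleIntegrable_of_lt {E : Type*} [NormedAddCommGroup E] {h : ℂ → E}
    {c : ℂ} {R r : ℝ} (hh : ContinuousOn h (ball c R)) (hr : |r| < R) :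
    CircleIntegrable h c r :=
  (hh.continuous_comp_circleMap hr).intervalIntegrable _ _

/-- The logarithmic derivative `r d/dr` of circle averages is the circle average of the derivative
along the Euler field `z - c`. -/
lemma hasDerivAt_circleAverage {h : ℂ → ℝ} {c : ℂ} {R r : ℝ} (hh : ContDiffOn ℝ 1 h (ball c R))
    (hr : r ∈ Ioo 0 R) :
    HasDerivAt (circleAverage h c)
      (r⁻¹ * circleAverage (fun z => fderiv ℝ h z (z - c)) c r) r := by
  have hD : ContinuousOn (fderiv ℝ h) (ball c R) := hh.continuousOn_fderiv_of_isOpen isOpen_ball le_rfl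
  have habs : ∀ x ∈ Ioo 0 R, |x| < R := fun x hx => by rw [abs_of_pos hx.1]; exact hx.2
  have key := (intervalIntegral.hasDerivAt_integral_of_continuousOn_deriv
    (F := fun r θ => h (circleMap c r θ))
    (F' := fun r θ => fderiv ℝ h (circleMap c r θ) (Complex.exp (θ * I)))
    isOpen_Ioo hr 0 (2 * π) (fun x hx => hh.continuousOn.continuous_comp_circleMap (habs x hx))
    ?_ ?_).const_smul (2 * π)⁻¹
  · convert! key using 1
    rw [circleAverage, smul_eq_mul, smul_eq_mul, mul_left_comm, ← intervalIntegral.integral_const_mul]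
    congr 1
    refine intervalIntegral.integral_congr fun θ _ => ?_
    have : circleMap c r θ - c = r • Complex.exp (θ * I) := by simp [circleMap]
    simp only [this, map_smul, smul_eq_mul]
    field_simp [hr.1.ne']
  · refine ContinuousOn.clm_apply (hD.comp (f := fun p : ℝ × ℝ => circleMap c p.1 p.2)
      circleMap.continuous.continuousOn ?_) (by fun_prop)
    intro p hp
    exact circleMap_mem_ball_of_abs_lt (habs _ hp.1) _
  · intro x hx θ
    have h1 : HasDerivAt (fun y : ℝ => circleMap c y θ) (Complex.exp (θ * I)) x := by
      simpa [circleMap] using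
        ((Complex.ofRealCLM.hasDerivAt (x := x)).mul_const (Complex.exp (θ * I))).const_add c
    have hm := circleMap_mem_ball_of_abs_lt (c := c) (habs x hx) θ
    exact ((hh.differentiableOn one_ne_zero).differentiableAt
      (isOpen_ball.mem_nhds hm)).hasFDerivAt.comp_hasDerivAt x h1

/-- The derivative along the rotation field `i(z - c)` is an angular derivative, so it averages to
zero over circles. -/
lemma circleAverage_fderiv_rotation_eq_zero {h : ℂ → ℝ} {c : ℂ} {R r : ℝ}
    (hh : ContDiffOn ℝ 1 h (ball c R)) (hr : |r| < R) :
    circleAverage (fun z => fderiv ℝ h z (I * (z - c))) c r = 0 := by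
  have hD : ContinuousOn (fderiv ℝ h) (ball c R) := hh.continuousOn_fderiv_of_isOpen isOpen_ball le_rfl
  have hcont : ContinuousOn (fun z => fderiv ℝ h z (I * (z - c))) (ball c R) :=
    hD.clm_apply (by fun_prop)
  have hd : ∀ θ : ℝ, HasDerivAt (fun θ => h (circleMap c r θ))
      (fderiv ℝ h (circleMap c r θ) (I * (circleMap c r θ - c))) θ := by
    intro θ
    have hm := circleMap_mem_ball_of_abs_lt (c := c) hr θ
    convert! ((hh.differentiableOn one_ne_zero).differentiableAt
      (isOpen_ball.mem_nhds hm)).hasFDerivAt.comp_hasDerivAt θ (hasDerivAt_circleMap c r θ) using 2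
    simp [circleMap, mul_comm]
  rw [circleAverage, intervalIntegral.integral_eq_sub_of_hasDerivAt (fun θ _ => hd θ)
    ((hcont.continuous_comp_circleMap hr).intervalIntegrable _ _)]
  have := periodic_circleMap c r 0
  simp only [zero_add] at this
  simp [this]

lemma ContDiffOn.contDiffOn_fderiv_comp_sub {g : ℂ → ℝ} {c : ℂ} {U : Set ℂ} (hU : IsOpen U)
    (hg : ContDiffOn ℝ 2 g U) (L : ℂ →L[ℝ] ℂ) :
    ContDiffOn ℝ 1 (fun y => fderiv ℝ g y (L (y - c))) U :=
  (hg.fderiv_of_isOpen hU (by norm_num)).clm_apply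
    (L.contDiff.comp_contDiffOn (contDiffOn_id.sub contDiffOn_const))

lemma fderiv_fderiv_comp_sub {g : ℂ → ℝ} {c z : ℂ} {U : Set ℂ} (hU : IsOpen U)
    (hg : ContDiffOn ℝ 2 g U) (hz : z ∈ U) (L : ℂ →L[ℝ] ℂ) (w : ℂ) :
    fderiv ℝ (fun y => fderiv ℝ g y (L (y - c))) z w =
      fderiv ℝ (fderiv ℝ g) z w (L (z - c)) + fderiv ℝ g z (L w) := by
  have h1 : DifferentiableAt ℝ (fderiv ℝ g) z :=
    ((hg.fderiv_of_isOpen hU (m := 1) (by norm_num)).differentiableOn one_ne_zero).differentiableAt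
      (hU.mem_nhds hz)
  have h2 : HasFDerivAt (fun y : ℂ => L (y - c)) L z :=
    L.hasFDerivAt.comp z ((hasFDerivAt_id z).sub_const c)
  rw [(h1.hasFDerivAt.clm_apply h2).fderiv]
  simp [add_comm]

lemma laplacian_eq_fderiv_fderiv {F : Type*} [NormedAddCommGroup F] [NormedSpace ℝ F]
    (g : ℂ → F) (z : ℂ) :
    Laplacian.laplacian g z =
      fderiv ℝ (fderiv ℝ g) z 1 1 + fderiv ℝ (fderiv ℝ g) z I I := by
  rw [InnerProductSpace.laplacian_eq_iteratedFDeriv_complexPlane]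
  simp [iteratedFDeriv_two_apply]

/-- The Laplacian is the trace of the Hessian in any orthogonal frame `ζ, iζ`. -/
lemma fderiv_fderiv_add_rotation (g : ℂ → ℝ) (z ζ : ℂ) :
    fderiv ℝ (fderiv ℝ g) z ζ ζ + fderiv ℝ (fderiv ℝ g) z (I * ζ) (I * ζ) =
      ‖ζ‖ ^ 2 * Laplacian.laplacian g z := by
  rw [laplacian_eq_fderiv_fderiv]
  generalize fderiv ℝ (fderiv ℝ g) z = B
  have h1 : ζ = ζ.re • (1 : ℂ) + ζ.im • I := by
    apply Complex.ext <;> simp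
  have h2 : I * ζ = (-ζ.im) • (1 : ℂ) + ζ.re • I := by
    apply Complex.ext <;> simp
  have h3 : ‖ζ‖ ^ 2 = ζ.re ^ 2 + ζ.im ^ 2 := by
    rw [Complex.sq_norm, Complex.normSq_apply]; ring
  rw [h2, h3]
  generalize ζ.re = a at *
  generalize ζ.im = b at *
  rw [h1]
  simp only [map_add, map_smul, add_apply, smul_apply,
    smul_eq_mul]
  ring

lemma ContDiffOn.continuousOn_laplacian {g : ℂ → ℝ} {U : Set ℂ} (hU : IsOpen U)
    (hg : ContDiffOn ℝ 2 g U) : ContinuousOn (Laplacian.laplacian g) U := by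
  have h2 : ContinuousOn (fderiv ℝ (fderiv ℝ g)) U :=
    (hg.fderiv_of_isOpen hU (m := 1) (by norm_num)).continuousOn_fderiv_of_isOpen hU le_rfl
  have : Laplacian.laplacian g = fun z =>
    fderiv ℝ (fderiv ℝ g) z 1 1 + fderiv ℝ (fderiv ℝ g) z I I :=
    funext (laplacian_eq_fderiv_fderiv g)
  rw [this]
  fun_prop

/-- Green's identity on disks, in differentiated form: the outward flux of `∇g` through the circle
of radius `r` grows at the rate `r` times the circle average of `Δg`. -/
lemma hasDerivAt_flux {g : ℂ → ℝ} {c : ℂ} {R r : ℝ} (hg : ContDiffOn ℝ 2 g (ball c R))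
    (hr : r ∈ Ioo 0 R) :
    HasDerivAt (circleAverage (fun z => fderiv ℝ g z (z - c)) c)
      (r * circleAverage (Laplacian.laplacian g) c r) r := by
  have habs : |r| < R := by rw [abs_of_pos hr.1]; exact hr.2
  let J : ℂ →L[ℝ] ℂ := ContinuousLinearMap.mul ℝ ℂ I
  have e1 := hg.contDiffOn_fderiv_comp_sub (c := c) isOpen_ball (ContinuousLinearMap.id ℝ ℂ)
  have e2 := hg.contDiffOn_fderiv_comp_sub (c := c) isOpen_ball J
  have d1 := hasDerivAt_circleAverage e1 hr
  have d2 := circleAverage_fderiv_rotation_eq_zero e2 habs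
  refine d1.congr_deriv ?_
  have i1 : CircleIntegrable (fun z => fderiv ℝ (fun y => fderiv ℝ g y
      ((ContinuousLinearMap.id ℝ ℂ) (y - c))) z (z - c)) c r :=
    ContinuousOn.circleIntegrable_of_lt
      ((e1.continuousOn_fderiv_of_isOpen isOpen_ball le_rfl).clm_apply (by fun_prop)) habs
  have i2 : CircleIntegrable (fun z => fderiv ℝ (fun y => fderiv ℝ g y (J (y - c))) z
      (I * (z - c))) c r :=
    ContinuousOn.circleIntegrable_of_lt
      ((e2.continuousOn_fderiv_of_isOpen isOpen_ball le_rfl).clm_apply (by fun_prop)) habs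
  have i3 : circleAverage (fun z => fderiv ℝ (fun y => fderiv ℝ g y
      ((ContinuousLinearMap.id ℝ ℂ) (y - c))) z (z - c)) c r =
      r ^ 2 * circleAverage (Laplacian.laplacian g) c r := by
    rw [← add_zero (circleAverage _ c r), ← d2, ← circleAverage_fun_add i1 i2, ← smul_eq_mul,
      ← circleAverage_fun_smul]
    refine circleAverage_congr_sphere fun z hz => ?_
    have hz' : ‖z - c‖ = |r| := by simpa [dist_eq_norm] using hz
    have hzb : z ∈ ball c R := by rw [mem_ball, dist_eq_norm, hz']; exact habs
    have hJ : ∀ w, J w = I * w := fun w => rfl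
    rw [fderiv_fderiv_comp_sub isOpen_ball hg hzb, fderiv_fderiv_comp_sub isOpen_ball hg hzb]
    have := fderiv_fderiv_add_rotation g z (z - c)
    rw [hz', sq_abs] at this
    simp only [hJ, ContinuousLinearMap.id_apply, smul_eq_mul, ← this]
    rw [← mul_assoc I I, I_mul_I, neg_one_mul, map_neg]
    ring
  rw [i3]
  field_simp [hr.1.ne']

lemma ContinuousOn.circleAverage_Ico {h : ℂ → ℝ} {c : ℂ} {R : ℝ} (hh : ContinuousOn h (ball c R)) :
    ContinuousOn (circleAverage h c) (Ico 0 R) :=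
  ContinuousOn.circleAverage (hh.mono fun z hz => by
    simpa [mem_ball, dist_eq_norm] using hz.2) fun _ hr => hr.1

lemma ContDiffOn.continuousOn_fderiv_euler {g : ℂ → ℝ} {c : ℂ} {R : ℝ}
    (hg : ContDiffOn ℝ 1 g (ball c R)) :
    ContinuousOn (fun z => fderiv ℝ g z (z - c)) (ball c R) :=
  (hg.continuousOn_fderiv_of_isOpen isOpen_ball le_rfl).clm_apply (by fun_prop)

lemma circleAverage_nonneg_of_forall_ball {h : ℂ → ℝ} {c : ℂ} {R r : ℝ}
    (hh : ∀ z ∈ ball c R, 0 ≤ h z) (hr : |r| < R) : 0 ≤ circleAverage h c r := by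
  refine smul_nonneg (by positivity) ?_
  exact intervalIntegral.integral_nonneg (by positivity)
    fun θ _ => hh _ (circleMap_mem_ball_of_abs_lt hr θ)

lemma circleAverage_flux_nonneg {g : ℂ → ℝ} {c : ℂ} {R r : ℝ} (hg : ContDiffOn ℝ 2 g (ball c R))
    (hΔ : ∀ z ∈ ball c R, 0 ≤ Laplacian.laplacian g z) (hr : r ∈ Ico 0 R) :
    0 ≤ circleAverage (fun z => fderiv ℝ g z (z - c)) c r := by
  have hg1 : ContDiffOn ℝ 1 g (ball c R) := hg.of_le (by norm_num)
  have hmono : MonotoneOn (circleAverage (fun z => fderiv ℝ g z (z - c)) c) (Ico 0 R) := by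
    refine monotoneOn_of_hasDerivWithinAt_nonneg (convex_Ico 0 R)
      hg1.continuousOn_fderiv_euler.circleAverage_Ico
      (f' := fun r => r * circleAverage (Laplacian.laplacian g) c r) ?_ ?_
    · intro x hx
      rw [interior_Ico] at hx
      exact (hasDerivAt_flux hg hx).hasDerivWithinAt
    · intro x hx
      rw [interior_Ico] at hx
      exact mul_nonneg hx.1.le (circleAverage_nonneg_of_forall_ball hΔ
        (by rw [abs_of_pos hx.1]; exact hx.2))
  have := hmono ⟨le_rfl, hr.1.trans_lt hr.2⟩ hr hr.1
  simpa using this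

lemma monotoneOn_circleAverage {g : ℂ → ℝ} {c : ℂ} {R : ℝ} (hg : ContDiffOn ℝ 2 g (ball c R))
    (hΔ : ∀ z ∈ ball c R, 0 ≤ Laplacian.laplacian g z) :
    MonotoneOn (circleAverage g c) (Ico 0 R) := by
  have hg1 : ContDiffOn ℝ 1 g (ball c R) := hg.of_le (by norm_num)
  refine monotoneOn_of_hasDerivWithinAt_nonneg (convex_Ico 0 R) hg.continuousOn.circleAverage_Ico
    (f' := fun r => r⁻¹ * circleAverage (fun z => fderiv ℝ g z (z - c)) c r) ?_ ?_
  · intro x hx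
    rw [interior_Ico] at hx
    exact (hasDerivAt_circleAverage hg1 hx).hasDerivWithinAt
  · intro x hx
    rw [interior_Ico] at hx
    exact mul_nonneg (inv_nonneg.2 hx.1.le) (circleAverage_flux_nonneg hg hΔ ⟨hx.1.le, hx.2⟩)

/-- The sub-mean value property of `C²` functions with nonnegative Laplacian. -/
lemma le_circleAverage_of_laplacian_nonneg {g : ℂ → ℝ} {c : ℂ} {R r : ℝ}
    (hg : ContDiffOn ℝ 2 g (ball c R))
    (hΔ : ∀ z ∈ ball c R, 0 ≤ Laplacian.laplacian g z) (hr : r ∈ Ico 0 R) :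
    g c ≤ circleAverage g c r := by
  have := monotoneOn_circleAverage hg hΔ ⟨le_rfl, hr.1.trans_lt hr.2⟩ hr hr.1
  simpa using this

/-- Circle averages of a subharmonic `g` on the unit disk stay bounded as soon as
`(1 - |z|) Δg` is dominated by a function with finite integral over the disk, here written in
polar coordinates. -/
lemma exists_circleAverage_le_of_laplacian_le {g H : ℂ → ℝ} {M : ℝ}
    (hg : ContDiffOn ℝ 2 g (ball 0 1)) (hΔ : ∀ z ∈ ball 0 1, 0 ≤ Laplacian.laplacian g z)
    (hH : ContinuousOn H (ball 0 1))
    (hgH : ∀ z ∈ ball 0 1, (1 - ‖z‖) * Laplacian.laplacian g z ≤ H z)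
    (hM : ∀ R ∈ Ioo (0 : ℝ) 1, ∫ r in 0..R, r * circleAverage H 0 r ≤ M) :
    ∃ C, ∀ R ∈ Ioo (0 : ℝ) 1, circleAverage g 0 R ≤ C := by
  have hg1 : ContDiffOn ℝ 1 g (ball 0 1) := hg.of_le (by norm_num)
  set A := circleAverage g 0
  set P := circleAverage (fun z => fderiv ℝ g z (z - 0)) 0 with hP
  set m := circleAverage (Laplacian.laplacian g) 0 with hm
  have hmc : ContinuousOn m (Ico 0 1) := (hg.continuousOn_laplacian isOpen_ball).circleAverage_Ico
  have hHc : ContinuousOn (circleAverage H 0) (Ico 0 1) := hH.circleAverage_Ico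
  have habs : ∀ x ∈ Ioo (0 : ℝ) 1, |x| < 1 := fun x hx => by rw [abs_of_pos hx.1]; exact hx.2
  have hmH : ∀ s ∈ Ioo (0 : ℝ) 1, (1 - s) * m s ≤ circleAverage H 0 s := by
    intro s hs
    rw [hm, ← smul_eq_mul, ← circleAverage_fun_smul]
    refine circleAverage_mono ?_ (hH.circleIntegrable_of_lt (habs s hs)) ?_
    · exact ContinuousOn.circleIntegrable_of_lt
        (continuousOn_const.mul (hg.continuousOn_laplacian isOpen_ball)) (habs s hs)
    · intro z hz
      have hz' : ‖z‖ = s := by simpa [abs_of_pos hs.1] using hz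
      have := hgH z (by simpa [hz'] using hs.2)
      simpa [hz'] using this
  have hint : ∀ a ∈ Ioo (0 : ℝ) 1, ∀ b ∈ Ioo (0 : ℝ) 1,
      IntervalIntegrable (fun s => (1 - s) * s * m s) volume a b := by
    intro a ha b hb
    refine ContinuousOn.intervalIntegrable (ContinuousOn.mul (by fun_prop) (hmc.mono ?_))
    exact (ordConnected_Ioo.uIcc_subset ha hb).trans Ioo_subset_Ico_self
  have hhalf : (1 / 2 : ℝ) ∈ Ioo (0 : ℝ) 1 := by constructor <;> norm_num
  have hsub : ∀ x ∈ Ico (1 / 2 : ℝ) 1, x ∈ Ioo (0 : ℝ) 1 := fun x hx => ⟨by linarith [hx.1], hx.2⟩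
  -- The auxiliary function `B` eliminates the Laplacian: `B' = (1/R - 2) P ≤ 0` for `R ≥ 1/2`.
  let B : ℝ → ℝ := fun R => A R + 2 * (1 - R) * P R - 2 * ∫ s in (1 / 2)..R, (1 - s) * s * m s
  have hB : ∀ R ∈ Ioo (0 : ℝ) 1, HasDerivAt B ((R⁻¹ - 2) * P R) R := by
    intro R hR
    have hc : ContinuousOn (fun s => (1 - s) * s * m s) (Ioo 0 1) :=
      ContinuousOn.mul (by fun_prop) (hmc.mono Ioo_subset_Ico_self)
    have d1 := hasDerivAt_circleAverage hg1 hR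
    have d2 := hasDerivAt_flux hg hR
    have d3 := intervalIntegral.integral_hasDerivAt_right (hint _ hhalf _ hR)
      (hc.stronglyMeasurableAtFilter isOpen_Ioo R hR) (hc.continuousAt (isOpen_Ioo.mem_nhds hR))
    have d4 : HasDerivAt (fun R : ℝ => 2 * (1 - R)) (-2) R := by
      simpa using ((hasDerivAt_id R).const_sub 1).const_mul 2
    refine ((d1.add (d4.mul d2)).sub (d3.const_mul 2)).congr_deriv ?_
    rw [← hP, ← hm]
    ring
  have hanti : AntitoneOn B (Ico (1 / 2) 1) := by
    refine antitoneOn_of_hasDerivWithinAt_nonpos (convex_Ico _ _)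
      (fun x hx => (hB x (hsub x hx)).continuousAt.continuousWithinAt)
      (fun x hx => (hB x (hsub x (interior_subset hx))).hasDerivWithinAt) ?_
    intro x hx
    have hx' := interior_subset hx
    refine mul_nonpos_of_nonpos_of_nonneg ?_
      (circleAverage_flux_nonneg hg hΔ ⟨(hsub x hx').1.le, hx'.2⟩)
    rw [sub_nonpos]
    exact (inv_anti₀ (by norm_num) hx'.1).trans (by norm_num)
  have hlarge : ∀ R ∈ Ico (1 / 2 : ℝ) 1, A R ≤ B (1 / 2) + 2 * M := by
    intro R hR
    have hR' := hsub R hR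
    have h1 := hanti ⟨le_rfl, by norm_num⟩ hR hR.1
    have h2 : 0 ≤ P R := circleAverage_flux_nonneg hg hΔ ⟨hR'.1.le, hR.2⟩
    have iH : ∀ a ∈ Ico (0 : ℝ) 1, ∀ b ∈ Ico (0 : ℝ) 1,
        IntervalIntegrable (fun s => s * circleAverage H 0 s) volume a b := fun a ha b hb =>
      ContinuousOn.intervalIntegrable (continuousOn_id.mul
        (hHc.mono (ordConnected_Ico.uIcc_subset ha hb)))
    have h3 : ∫ s in (1 / 2)..R, (1 - s) * s * m s ≤ ∫ s in (1 / 2)..R, s * circleAverage H 0 s := by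
      refine intervalIntegral.integral_mono_on hR.1 (hint _ hhalf _ hR')
        (iH _ ⟨hhalf.1.le, hhalf.2⟩ _ ⟨hR'.1.le, hR.2⟩) fun s hs => ?_
      have hs' := hsub s ⟨hs.1, hs.2.trans_lt hR.2⟩
      have := mul_le_mul_of_nonneg_left (hmH s hs') hs'.1.le
      linarith
    have h4 : 0 ≤ ∫ s in 0..(1 / 2), s * circleAverage H 0 s := by
      refine intervalIntegral.integral_nonneg (by norm_num) fun s hs => ?_
      have hs1 : |s| < 1 := by rw [abs_of_nonneg hs.1]; linarith [hs.2]
      refine mul_nonneg hs.1 (circleAverage_nonneg_of_forall_ball (fun z hz => ?_) hs1)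
      refine le_trans (mul_nonneg ?_ (hΔ z hz)) (hgH z hz)
      rw [mem_ball_zero_iff] at hz
      linarith
    have h5 := intervalIntegral.integral_add_adjacent_intervals
      (iH 0 ⟨le_rfl, one_pos⟩ _ ⟨hhalf.1.le, hhalf.2⟩)
      (iH _ ⟨hhalf.1.le, hhalf.2⟩ R ⟨hR'.1.le, hR.2⟩)
    have h6 := hM R hR'
    have h7 : 0 ≤ 2 * (1 - R) * P R := mul_nonneg (by linarith [hR.2]) h2
    have h8 : B R = A R + 2 * (1 - R) * P R - 2 * ∫ s in (1 / 2)..R, (1 - s) * s * m s := rfl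
    linarith
  refine ⟨B (1 / 2) + 2 * M, fun R hR => ?_⟩
  rcases le_total (1 / 2) R with h | h
  · exact hlarge R ⟨h, hR.2⟩
  · exact (monotoneOn_circleAverage hg hΔ ⟨hR.1.le, hR.2⟩ ⟨hhalf.1.le, hhalf.2⟩ h).trans
      (hlarge _ ⟨le_rfl, hhalf.2⟩)

/-! ### Integration in polar coordinates -/

lemma setIntegral_closedBall_eq_integral_circleAverage {H : ℂ → ℝ} {c : ℂ} {R : ℝ} (hR : 0 ≤ R)
    (hH : ContinuousOn H (closedBall c R)) :
    ∫ z in closedBall c R, H z = 2 * π * ∫ r in 0..R, r * circleAverage H c r := by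
  have h1 : ∫ z in closedBall c R, H z =
      ∫ p in Ioc 0 R ×ˢ Ioo (-π) π, p.1 * H (circleMap c p.1 p.2) := by
    rw [← integral_indicator measurableSet_closedBall, ← integral_add_right_eq_self _ c,
      ← Complex.integral_comp_polarCoord_symm, show polarCoord.target = Ioi (0 : ℝ) ×ˢ Ioo (-π) π from rfl,
      ← integral_indicator (measurableSet_Ioi.prod measurableSet_Ioo),
      ← integral_indicator (measurableSet_Ioc.prod measurableSet_Ioo)]
    congr 1
    ext p
    have hp : Complex.polarCoord.symm p + c = circleMap c p.1 p.2 := by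
      simp [circleMap, Complex.exp_mul_I, add_comm]
    have hd : dist (circleMap c p.1 p.2) c = |p.1| := by simp [dist_eq_norm, circleMap]
    simp only [indicator_apply, mem_prod, mem_Ioi, mem_Ioc, hp, smul_eq_mul]
    by_cases h0 : 0 < p.1
    · simp only [h0, true_and]
      by_cases h2 : p.2 ∈ Ioo (-π) π <;> by_cases h3 : p.1 ≤ R <;>
        simp [h2, h3, hd, abs_of_pos h0]
    · simp [h0]
  have hc : ContinuousOn (fun p : ℝ × ℝ => p.1 * H (circleMap c p.1 p.2))
      (Icc 0 R ×ˢ Icc (-π) π) := by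
    refine continuousOn_fst.mul (hH.comp (f := fun p : ℝ × ℝ => circleMap c p.1 p.2)
      circleMap.continuous.continuousOn fun p hp => ?_)
    simpa [mem_closedBall, dist_eq_norm, circleMap, abs_of_nonneg hp.1.1] using hp.1.2
  rw [h1, Measure.volume_eq_prod, setIntegral_prod, ← intervalIntegral.integral_of_le hR,
    ← intervalIntegral.integral_const_mul]
  · refine intervalIntegral.integral_congr fun r _ => ?_
    have hper : Function.Periodic (fun θ => H (circleMap c r θ)) (2 * π) := fun x => by
      simp only [periodic_circleMap c r x]
    have := hper.intervalIntegral_add_eq 0 (-π)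
    rw [zero_add, show -π + 2 * π = π by ring] at this
    simp only [integral_const_mul, circleAverage, this, smul_eq_mul]
    rw [← integral_Ioc_eq_integral_Ioo, ← intervalIntegral.integral_of_le (by linarith [pi_pos])]
    field_simp [pi_pos.ne']
  · exact (hc.integrableOn_compact (isCompact_Icc.prod isCompact_Icc)).mono_set
      (prod_mono Ioc_subset_Icc_self Ioo_subset_Icc_self)

/-! ### Laplacians of composite functions -/

section Laplacian

variable {F : Type*} [NormedAddCommGroup F] [NormedSpace ℝ F]

lemma ContDiffOn.differentiableAt_fderiv {f : ℂ → F} {U : Set ℂ} {z : ℂ} (hU : IsOpen U)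
    (hf : ContDiffOn ℝ 2 f U) (hz : z ∈ U) : DifferentiableAt ℝ (fderiv ℝ f) z :=
  ((hf.fderiv_of_isOpen hU (m := 1) (by norm_num)).differentiableOn one_ne_zero).differentiableAt
    (hU.mem_nhds hz)

lemma fderiv_fderiv_apply_eq {f : ℂ → F} {z : ℂ} (h : DifferentiableAt ℝ (fderiv ℝ f) z) (v : ℂ) :
    fderiv ℝ (fderiv ℝ f) z v v = fderiv ℝ (fun y => fderiv ℝ f y v) z v := by
  rw [(h.hasFDerivAt.clm_apply (hasFDerivAt_const v z)).fderiv]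
  simp

lemma laplacian_comp_add_right (f : ℂ → F) (a z : ℂ) :
    Laplacian.laplacian (fun y => f (y + a)) z = Laplacian.laplacian f (z + a) := by
  have h : fderiv ℝ (fun y => f (y + a)) = fun y => fderiv ℝ f (y + a) :=
    funext fun y => fderiv_comp_add_right a
  rw [laplacian_eq_fderiv_fderiv, laplacian_eq_fderiv_fderiv, h, fderiv_comp_add_right]

end Laplacian

lemma fderiv_norm_sq_add_one {f : ℂ → ℂ} {z : ℂ} (hf : DifferentiableAt ℝ f z) (v : ℂ) :
    fderiv ℝ (fun y => ‖f y‖ ^ 2 + 1) z v = 2 * ⟪f z, fderiv ℝ f z v⟫_ℝ := by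
  rw [(hf.hasFDerivAt.norm_sq.add_const 1).fderiv]
  simp [mul_add]

lemma laplacian_norm_sq_add_one {f : ℂ → ℂ} {U : Set ℂ} {z : ℂ} (hU : IsOpen U)
    (hf : ContDiffOn ℝ 2 f U) (hz : z ∈ U) :
    Laplacian.laplacian (fun y => ‖f y‖ ^ 2 + 1 : ℂ → ℝ) z =
      2 * (‖fderiv ℝ f z 1‖ ^ 2 + ‖fderiv ℝ f z I‖ ^ 2) +
        2 * ⟪f z, Laplacian.laplacian f z⟫_ℝ := by
  have hw : ContDiffOn ℝ 2 (fun y => ‖f y‖ ^ 2 + 1) U := (hf.norm_sq ℝ).add contDiffOn_const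
  have hfd : ∀ y ∈ U, DifferentiableAt ℝ f y := fun y hy =>
    (hf.differentiableOn two_ne_zero).differentiableAt (hU.mem_nhds hy)
  have key : ∀ v, fderiv ℝ (fderiv ℝ (fun y => ‖f y‖ ^ 2 + 1)) z v v =
      2 * ‖fderiv ℝ f z v‖ ^ 2 + 2 * ⟪f z, fderiv ℝ (fderiv ℝ f) z v v⟫_ℝ := by
    intro v
    have hev : (fun y => fderiv ℝ (fun y => ‖f y‖ ^ 2 + 1) y v) =ᶠ[𝓝 z]
        fun y => 2 * ⟪f y, fderiv ℝ f y v⟫_ℝ := by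
      filter_upwards [hU.mem_nhds hz] with y hy using fderiv_norm_sq_add_one (hfd y hy) v
    have hdd := hf.differentiableAt_fderiv hU hz
    have hdv : DifferentiableAt ℝ (fun y => fderiv ℝ f y v) z :=
      hdd.clm_apply (differentiableAt_const v)
    rw [fderiv_fderiv_apply_eq (hw.differentiableAt_fderiv hU hz), hev.fderiv_eq,
      fderiv_const_mul ((hfd z hz).inner ℝ hdv), fderiv_fderiv_apply_eq hdd]
    simp only [smul_apply, smul_eq_mul]
    rw [fderiv_inner_apply ℝ (hfd z hz) hdv, real_inner_self_eq_norm_sq]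
    ring
  rw [laplacian_eq_fderiv_fderiv, laplacian_eq_fderiv_fderiv, key, key, inner_add_right]
  ring

lemma laplacian_rpow {w : ℂ → ℝ} {U : Set ℂ} {z : ℂ} (hU : IsOpen U) (hw : ContDiffOn ℝ 2 w U)
    (hpos : ∀ y ∈ U, 0 < w y) (hz : z ∈ U) (q : ℝ) :
    Laplacian.laplacian (fun y => w y ^ q) z = q * w z ^ (q - 1) * Laplacian.laplacian w z +
      q * (q - 1) * w z ^ (q - 2) * (fderiv ℝ w z 1 ^ 2 + fderiv ℝ w z I ^ 2) := by
  have hwq : ContDiffOn ℝ 2 (fun y => w y ^ q) U :=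
    hw.rpow_const_of_ne fun y hy => (hpos y hy).ne'
  have hwd : ∀ y ∈ U, DifferentiableAt ℝ w y := fun y hy =>
    (hw.differentiableOn two_ne_zero).differentiableAt (hU.mem_nhds hy)
  have hd : ∀ s : ℝ, ∀ y ∈ U, ∀ v, fderiv ℝ (fun y => w y ^ s) y v =
      s * w y ^ (s - 1) * fderiv ℝ w y v := by
    intro s y hy v
    rw [((hwd y hy).hasFDerivAt.rpow_const (p := s) (Or.inl (hpos y hy).ne')).fderiv]
    simp
  have key : ∀ v, fderiv ℝ (fderiv ℝ (fun y => w y ^ q)) z v v =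
      q * w z ^ (q - 1) * fderiv ℝ (fderiv ℝ w) z v v +
        q * (q - 1) * w z ^ (q - 2) * fderiv ℝ w z v ^ 2 := by
    intro v
    have hev : (fun y => fderiv ℝ (fun y => w y ^ q) y v) =ᶠ[𝓝 z]
        fun y => q * (w y ^ (q - 1) * fderiv ℝ w y v) := by
      filter_upwards [hU.mem_nhds hz] with y hy
      rw [hd q y hy v, mul_assoc]
    have hdd := hw.differentiableAt_fderiv hU hz
    have hdv : DifferentiableAt ℝ (fun y => fderiv ℝ w y v) z :=
      hdd.clm_apply (differentiableAt_const v)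
    have hdp : DifferentiableAt ℝ (fun y => w y ^ (q - 1)) z :=
      (hwd z hz).rpow_const (Or.inl (hpos z hz).ne')
    rw [fderiv_fderiv_apply_eq (hwq.differentiableAt_fderiv hU hz), hev.fderiv_eq,
      fderiv_const_mul (hdp.fun_mul hdv), fderiv_fderiv_apply_eq hdd, fderiv_fun_mul hdp hdv]
    simp only [smul_apply, smul_eq_mul, add_apply]
    rw [hd (q - 1) z hz v, show q - 1 - 1 = q - 2 by ring]
    ring
  rw [laplacian_eq_fderiv_fderiv, laplacian_eq_fderiv_fderiv, key, key]
  ring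

lemma inner_ofReal_mul_self (lam : ℝ) (a : ℂ) : ⟪a, (lam : ℂ) * a⟫_ℝ = lam * ‖a‖ ^ 2 := by
  rw [← Complex.real_smul, inner_smul_right, real_inner_self_eq_norm_sq]

lemma laplacian_norm_sq_add_one_nonneg {f : ℂ → ℂ} {U : Set ℂ} {z : ℂ} {lam : ℝ} (hlam : 0 ≤ lam)
    (hU : IsOpen U) (hf : ContDiffOn ℝ 2 f U) (hz : z ∈ U)
    (hpde : Laplacian.laplacian f z = (lam : ℂ) * f z) :
    0 ≤ Laplacian.laplacian (fun y => ‖f y‖ ^ 2 + 1 : ℂ → ℝ) z := by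
  rw [laplacian_norm_sq_add_one hU hf hz, hpde, inner_ofReal_mul_self]
  positivity

lemma laplacian_rpow_norm_sq_add_one_nonneg {f : ℂ → ℂ} {U : Set ℂ} {z : ℂ} {lam q : ℝ}
    (hlam : 0 ≤ lam) (hq : 1 ≤ q) (hU : IsOpen U) (hf : ContDiffOn ℝ 2 f U) (hz : z ∈ U)
    (hpde : Laplacian.laplacian f z = (lam : ℂ) * f z) :
    0 ≤ Laplacian.laplacian (fun y => (‖f y‖ ^ 2 + 1) ^ q : ℂ → ℝ) z := by
  rw [laplacian_rpow hU ((hf.norm_sq ℝ).add contDiffOn_const) (fun y _ => by positivity) hz]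
  have := laplacian_norm_sq_add_one_nonneg hlam hU hf hz hpde
  have hq' : 0 ≤ q - 1 := by linarith
  positivity

/-- For `q ≥ 1` the gradient term `(q - 1) w^(q-2) |∇w|²` is absorbed by `w^(q-1) ‖Df‖²`, because
`|∇w| ≤ 2 √w ‖Df‖` for `w = |f|² + 1`. -/
lemma laplacian_rpow_norm_sq_add_one_le {f : ℂ → ℂ} {U : Set ℂ} {z : ℂ} {lam q : ℝ}
    (hlam : 0 ≤ lam) (hq : 1 ≤ q) (hU : IsOpen U) (hf : ContDiffOn ℝ 2 f U) (hz : z ∈ U)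
    (hpde : Laplacian.laplacian f z = (lam : ℂ) * f z) :
    Laplacian.laplacian (fun y => (‖f y‖ ^ 2 + 1) ^ q : ℂ → ℝ) z ≤
      8 * q ^ 2 * (‖f z‖ ^ 2 + 1) ^ (q - 1) * ‖fderiv ℝ f z‖ ^ 2 +
        2 * q * lam * (‖f z‖ ^ 2 + 1) ^ q := by
  have hfd : DifferentiableAt ℝ f z :=
    (hf.differentiableOn two_ne_zero).differentiableAt (hU.mem_nhds hz)
  rw [laplacian_rpow hU ((hf.norm_sq ℝ).add contDiffOn_const) (fun y _ => by positivity) hz,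
    laplacian_norm_sq_add_one hU hf hz, hpde, inner_ofReal_mul_self,
    fderiv_norm_sq_add_one hfd, fderiv_norm_sq_add_one hfd]
  set w := ‖f z‖ ^ 2 + 1 with hw
  have hw0 : 0 < w := by positivity
  have hv : ∀ v : ℂ, ‖v‖ = 1 → ‖fderiv ℝ f z v‖ ^ 2 ≤ ‖fderiv ℝ f z‖ ^ 2 := by
    intro v hv
    have := (fderiv ℝ f z).le_opNorm v
    rw [hv, mul_one] at this
    gcongr
  have hi : ∀ v : ℂ, ‖v‖ = 1 →
      (2 * ⟪f z, fderiv ℝ f z v⟫_ℝ) ^ 2 ≤ 4 * (w * ‖fderiv ℝ f z‖ ^ 2) := by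
    intro v h1
    have h2 : ⟪f z, fderiv ℝ f z v⟫_ℝ ^ 2 ≤ (‖f z‖ * ‖fderiv ℝ f z v‖) ^ 2 := by
      rw [← sq_abs]
      gcongr
      exact abs_real_inner_le_norm _ _
    have h3 : ‖f z‖ ^ 2 * ‖fderiv ℝ f z v‖ ^ 2 ≤ w * ‖fderiv ℝ f z‖ ^ 2 :=
      mul_le_mul (by linarith) (hv v h1) (by positivity) hw0.le
    rw [mul_pow] at h2 ⊢
    linarith
  have e1 : w ^ (q - 2) * w = w ^ (q - 1) := by
    rw [← Real.rpow_add_one hw0.ne']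
    ring_nf
  have e2 : w ^ (q - 1) * w = w ^ q := by
    rw [← Real.rpow_add_one hw0.ne']
    ring_nf
  have hq0 : 0 ≤ q - 1 := by linarith
  set N := ‖fderiv ℝ f z‖ ^ 2
  calc _ ≤ q * w ^ (q - 1) * (2 * (N + N) + 2 * (lam * w)) +
        q * (q - 1) * w ^ (q - 2) * (4 * (w * N) + 4 * (w * N)) := by
        gcongr
        · exact hv 1 (by simp)
        · exact hv I (by simp)
        · linarith
        · exact hi 1 (by simp)
        · exact hi I (by simp)
    _ = (4 * q + 8 * (q * (q - 1))) * w ^ (q - 1) * N + 2 * q * lam * w ^ q := by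
        rw [← e2, ← e1]
        ring
    _ ≤ _ := by
        gcongr
        nlinarith

/-! ### Growth of solutions of finite weighted energy -/

/-- Directional derivatives of solutions of `Δf = λf` satisfy the sub-mean value inequality. As
`f` is only `C²`, this is obtained as the limit of the inequality for difference quotients, which
solve the same equation. -/
lemma norm_fderiv_apply_sq_le_circleAverage {f : ℂ → ℂ} {c : ℂ} {R r lam : ℝ} (hlam : 0 ≤ lam)
    (hf : ContDiffOn ℝ 2 f (ball c R))
    (hpde : ∀ z ∈ ball c R, Laplacian.laplacian f z = (lam : ℂ) * f z)
    (hr : r ∈ Ico 0 R) (v : ℂ) :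
    ‖fderiv ℝ f c v‖ ^ 2 ≤ circleAverage (fun z => ‖fderiv ℝ f z v‖ ^ 2) c r := by
  obtain ⟨hr0, hrR⟩ := hr
  set δ := (R - r) / 2 with hδ
  have hδ0 : 0 < δ := by rw [hδ]; linarith
  have hsub : closedBall c (r + δ) ⊆ ball c R := closedBall_subset_ball (by rw [hδ]; linarith)
  -- The difference quotients of `f` in direction `v`.
  let u : ℝ → ℂ → ℂ := fun t y => t⁻¹ • (f (y + t • v) - f y)
  have hsmall : ∀ᶠ t : ℝ in 𝓝[≠] 0, ‖t • v‖ < δ := by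
    refine eventually_nhdsWithin_of_eventually_nhds ?_
    have : Tendsto (fun t : ℝ => ‖t • v‖) (𝓝 0) (𝓝 ‖(0 : ℝ) • v‖) :=
      Continuous.tendsto (by fun_prop) 0
    exact this.eventually_lt_const (by simpa using hδ0)
  have hshift : ∀ {t : ℝ}, ‖t • v‖ < δ → ∀ y ∈ ball c (r + δ), y + t • v ∈ ball c R := by
    intro t ht y hy
    rw [mem_ball, dist_eq_norm] at hy ⊢
    calc ‖y + t • v - c‖ = ‖(y - c) + t • v‖ := by ring_nf
      _ ≤ ‖y - c‖ + ‖t • v‖ := norm_add_le _ _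
      _ < (r + δ) + δ := add_lt_add hy ht
      _ = R := by rw [hδ]; ring
  -- The summand `1` only serves to match the form of the Laplacian formula; it cancels at the end.
  have hineq : ∀ᶠ t : ℝ in 𝓝[≠] 0, ‖u t c‖ ^ 2 + 1 ≤ circleAverage (fun z => ‖u t z‖ ^ 2 + 1) c r := by
    filter_upwards [hsmall] with t ht
    have hs : ContDiffOn ℝ 2 (fun y => f (y + t • v)) (ball c (r + δ)) :=
      hf.comp (contDiffOn_id.add contDiffOn_const) (hshift ht)
    have hf' : ContDiffOn ℝ 2 f (ball c (r + δ)) := hf.mono (ball_subset_closedBall.trans hsub)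
    have hu : ContDiffOn ℝ 2 (u t) (ball c (r + δ)) := (hs.sub hf').const_smul t⁻¹
    refine le_circleAverage_of_laplacian_nonneg (g := fun z => ‖u t z‖ ^ 2 + 1)
      ((hu.norm_sq ℝ).add contDiffOn_const) (fun z hz => ?_) ⟨hr0, by linarith⟩
    refine laplacian_norm_sq_add_one_nonneg hlam isOpen_ball hu hz ?_
    have a1 : ContDiffAt ℝ 2 (fun y => f (y + t • v)) z := hs.contDiffAt (isOpen_ball.mem_nhds hz)
    have a2 : ContDiffAt ℝ 2 f z := hf'.contDiffAt (isOpen_ball.mem_nhds hz)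
    have a3 : ContDiffAt ℝ 2 ((fun y => f (y + t • v)) - f) z := a1.sub a2
    have e : u t = t⁻¹ • ((fun y => f (y + t • v)) - f) := rfl
    rw [e, InnerProductSpace.laplacian_smul _ a3, a1.laplacian_sub a2,
      laplacian_comp_add_right, hpde _ (hshift ht z hz),
      hpde z (hsub (ball_subset_closedBall hz))]
    simp only [Pi.smul_apply, Pi.sub_apply, Complex.real_smul]
    ring
  have hlim : ∀ y ∈ ball c R, Tendsto (fun t => ‖u t y‖ ^ 2 + 1) (𝓝[≠] 0)
      (𝓝 (‖fderiv ℝ f y v‖ ^ 2 + 1)) := by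
    intro y hy
    have h1 : DifferentiableAt ℝ f y :=
      (hf.differentiableOn two_ne_zero).differentiableAt (isOpen_ball.mem_nhds hy)
    have h2 := (h1.hasFDerivAt.hasLineDerivAt v).tendsto_slope_zero
    exact (h2.norm.pow 2).add_const 1
  have hDc : ContinuousOn (fderiv ℝ f) (ball c R) :=
    hf.continuousOn_fderiv_of_isOpen isOpen_ball (by norm_num)
  obtain ⟨M, hM⟩ := (isCompact_closedBall c (r + δ)).exists_bound_of_continuousOn (hDc.mono hsub)
  have hM0 : 0 ≤ M := (norm_nonneg _).trans (hM c (mem_closedBall_self (by linarith)))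
  have habs : |r| < R := by rwa [abs_of_nonneg hr0]
  have hlimavg : Tendsto (fun t => circleAverage (fun z => ‖u t z‖ ^ 2 + 1) c r) (𝓝[≠] 0)
      (𝓝 (circleAverage (fun z => ‖fderiv ℝ f z v‖ ^ 2 + 1) c r)) := by
    refine Tendsto.const_smul ?_ _
    refine intervalIntegral.tendsto_integral_filter_of_dominated_convergence
      (fun _ => (M * ‖v‖) ^ 2 + 1) ?_ ?_ (by simp) ?_
    · filter_upwards [hsmall] with t ht
      have hs : ContinuousOn (fun y => f (y + t • v)) (ball c (r + δ)) :=
        hf.continuousOn.comp (by fun_prop) (hshift ht)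
      have hf' : ContinuousOn f (ball c (r + δ)) :=
        hf.continuousOn.mono (ball_subset_closedBall.trans hsub)
      have : ContinuousOn (fun z => ‖u t z‖ ^ 2 + 1) (ball c (r + δ)) :=
        (((hs.sub hf').const_smul t⁻¹).norm.pow 2).add continuousOn_const
      exact (this.continuous_comp_circleMap
        (by rw [abs_of_nonneg hr0]; linarith)).aestronglyMeasurable
    · filter_upwards [hsmall, self_mem_nhdsWithin] with t ht ht0
      refine Eventually.of_forall fun θ _ => ?_
      have hy : circleMap c r θ ∈ closedBall c (r + δ) :=
        closedBall_subset_closedBall (by linarith) (circleMap_mem_closedBall c hr0 θ)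
      generalize hyd : circleMap c r θ = y at hy
      have hyr : ‖y - c‖ = r := by
        rw [← hyd]; simp [circleMap, abs_of_nonneg hr0]
      have hy2 : y + t • v ∈ closedBall c (r + δ) := by
        rw [mem_closedBall, dist_eq_norm]
        calc ‖y + t • v - c‖ = ‖(y - c) + t • v‖ := by ring_nf
          _ ≤ ‖y - c‖ + ‖t • v‖ := norm_add_le _ _
          _ ≤ r + δ := by rw [hyr]; linarith
      have hle : ‖f (y + t • v) - f y‖ ≤ M * ‖y + t • v - y‖ :=
        (convex_closedBall c (r + δ)).norm_image_sub_le_of_norm_fderiv_le (𝕜 := ℝ)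
          (fun x hx => (hf.differentiableOn two_ne_zero).differentiableAt
            (isOpen_ball.mem_nhds (hsub hx))) hM hy hy2
      have hu : ‖u t y‖ ≤ M * ‖v‖ := by
        have ht1 : 0 < |t| := abs_pos.2 ht0
        calc ‖u t y‖ = |t|⁻¹ * ‖f (y + t • v) - f y‖ := by simp [u]
          _ ≤ |t|⁻¹ * (M * ‖y + t • v - y‖) := by gcongr
          _ = M * ‖v‖ := by
            rw [add_sub_cancel_left, norm_smul, Real.norm_eq_abs]
            field_simp
      rw [Real.norm_of_nonneg (by positivity)]
      gcongr
    · exact Eventually.of_forall fun θ _ => hlim _ (circleMap_mem_ball_of_abs_lt habs θ)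
  have hfin := le_of_tendsto_of_tendsto
    (hlim c (mem_ball_self (hr0.trans_lt hrR))) hlimavg hineq
  have hci : CircleIntegrable (fun z => ‖fderiv ℝ f z v‖ ^ 2) c r :=
    ContinuousOn.circleIntegrable_of_lt
      ((hDc.clm_apply continuousOn_const).norm.pow 2) habs
  rw [circleAverage_fun_add hci (circleIntegrable_const _ _ _), circleAverage_const] at hfin
  linarith

/-- Pointwise gradient bound: average the sub-mean value inequality over the disk of radius
`(1 - |z|) / 2` about `z`, on which the weight `(1 - |y|)^γ` is at least `((1 - |z|) / 2)^γ`. -/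
lemma norm_fderiv_sq_le_of_integrableOn {f : ℂ → ℂ} {γ lam : ℝ} (hγ : 0 < γ) (hlam : 0 ≤ lam)
    (hf : ContDiffOn ℝ 2 f (ball 0 1))
    (hpde : ∀ z ∈ ball 0 1, Laplacian.laplacian f z = (lam : ℂ) * f z)
    (hint : IntegrableOn (fun z => (1 - ‖z‖) ^ γ * ‖fderiv ℝ f z‖ ^ 2) (ball 0 1))
    {z : ℂ} (hz : z ∈ ball 0 1) :
    ‖fderiv ℝ f z‖ ^ 2 ≤ (∫ y in ball 0 1, (1 - ‖y‖) ^ γ * ‖fderiv ℝ f y‖ ^ 2) / π *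
      ((1 - ‖z‖) / 2) ^ (-(2 + γ)) := by
  set E := ∫ y in ball 0 1, (1 - ‖y‖) ^ γ * ‖fderiv ℝ f y‖ ^ 2
  rw [mem_ball_zero_iff] at hz
  set ρ := (1 - ‖z‖) / 2 with hρ
  have hρ0 : 0 < ρ := by rw [hρ]; linarith
  have hball : ball z (2 * ρ) ⊆ ball 0 1 := by
    refine ball_subset_ball' ?_
    rw [hρ, dist_zero_right]; linarith
  have hcb : closedBall z ρ ⊆ ball 0 1 := (closedBall_subset_ball (by linarith)).trans hball
  have hDc : ContinuousOn (fderiv ℝ f) (ball 0 1) :=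
    hf.continuousOn_fderiv_of_isOpen isOpen_ball (by norm_num)
  have hdist : ∀ y ∈ closedBall z ρ, ρ ≤ 1 - ‖y‖ := by
    intro y hy
    rw [mem_closedBall, dist_eq_norm] at hy
    have := norm_sub_norm_le y z
    rw [hρ] at hy ⊢
    linarith
  have hE : ρ ^ γ * ∫ y in closedBall z ρ, ‖fderiv ℝ f y‖ ^ 2 ≤ E := by
    rw [← integral_const_mul]
    refine le_trans (setIntegral_mono_on ?_ (hint.mono_set hcb) measurableSet_closedBall ?_)
      (setIntegral_mono_set hint ?_ hcb.eventuallyLE)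
    · exact ((hDc.mono hcb).norm.pow 2).const_mul _ |>.integrableOn_compact
        (isCompact_closedBall _ _)
    · intro y hy
      have := hdist y hy
      gcongr
    · refine (ae_restrict_mem measurableSet_ball).mono fun y hy => ?_
      rw [mem_ball_zero_iff] at hy
      have : 0 ≤ 1 - ‖y‖ := by linarith
      simp only [Pi.zero_apply]
      positivity
  have hv : ∀ v : ℂ, ‖fderiv ℝ f z v‖ ^ 2 ≤ E / π * ρ ^ (-(2 + γ)) * ‖v‖ ^ 2 := by
    intro v
    have hc : ContinuousOn (fun y => ‖fderiv ℝ f y v‖ ^ 2) (ball 0 1) :=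
      (hDc.clm_apply continuousOn_const).norm.pow 2
    have h1 := setIntegral_closedBall_eq_integral_circleAverage hρ0.le (hc.mono hcb)
    have h2 : ∫ r in 0..ρ, r * ‖fderiv ℝ f z v‖ ^ 2 ≤
        ∫ r in 0..ρ, r * circleAverage (fun y => ‖fderiv ℝ f y v‖ ^ 2) z r := by
      refine intervalIntegral.integral_mono_on hρ0.le
        (Continuous.intervalIntegrable (by fun_prop) _ _) ?_ fun r hr => ?_
      · refine ContinuousOn.intervalIntegrable (continuousOn_id.mul ?_)
        rw [uIcc_of_le hρ0.le]
        exact (hc.mono hball).circleAverage_Ico.mono fun r hr => ⟨hr.1, by linarith [hr.2]⟩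
      · exact mul_le_mul_of_nonneg_left (norm_fderiv_apply_sq_le_circleAverage hlam
          (hf.mono hball) (fun y hy => hpde y (hball hy)) ⟨hr.1, by linarith [hr.2]⟩ v) hr.1
    have h3 : ∫ r in 0..ρ, r * ‖fderiv ℝ f z v‖ ^ 2 = ρ ^ 2 / 2 * ‖fderiv ℝ f z v‖ ^ 2 := by
      rw [intervalIntegral.integral_mul_const, integral_id]
      ring
    have h4 : ∫ y in closedBall z ρ, ‖fderiv ℝ f y v‖ ^ 2 ≤
        (∫ y in closedBall z ρ, ‖fderiv ℝ f y‖ ^ 2) * ‖v‖ ^ 2 := by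
      rw [← integral_mul_const]
      refine setIntegral_mono_on ((hc.mono hcb).integrableOn_compact (isCompact_closedBall _ _))
        ((((hDc.mono hcb).norm.pow 2).mul continuousOn_const).integrableOn_compact
          (isCompact_closedBall _ _)) measurableSet_closedBall fun y _ => ?_
      rw [← mul_pow]
      gcongr
      exact (fderiv ℝ f y).le_opNorm v
    have h5 : (∫ y in closedBall z ρ, ‖fderiv ℝ f y‖ ^ 2) ≤ E / ρ ^ γ := by
      rw [le_div_iff₀ (by positivity)]
      linarith
    have h6 : π * ρ ^ 2 * ‖fderiv ℝ f z v‖ ^ 2 ≤ E / ρ ^ γ * ‖v‖ ^ 2 := by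
      have h7 := mul_le_mul_of_nonneg_right h5 (sq_nonneg ‖v‖)
      have h8 := mul_le_mul_of_nonneg_left h2 (by positivity : 0 ≤ 2 * π)
      rw [h3, ← h1] at h8
      linarith
    rw [Real.rpow_neg hρ0.le, Real.rpow_add hρ0, Real.rpow_two]
    calc ‖fderiv ℝ f z v‖ ^ 2 = (π * ρ ^ 2 * ‖fderiv ℝ f z v‖ ^ 2) / (π * ρ ^ 2) := by
          field_simp
      _ ≤ (E / ρ ^ γ * ‖v‖ ^ 2) / (π * ρ ^ 2) := by gcongr
      _ = _ := by field_simp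
  have hnn : 0 ≤ E / π * ρ ^ (-(2 + γ)) := by
    have := (sq_nonneg _).trans (hv 1)
    simpa using this
  have := ContinuousLinearMap.opNorm_le_bound (fderiv ℝ f z) (Real.sqrt_nonneg _) fun v => by
    rw [← Real.sqrt_sq (norm_nonneg v), ← Real.sqrt_mul hnn]
    exact Real.le_sqrt_of_sq_le (hv v)
  calc _ ≤ √(E / π * ρ ^ (-(2 + γ))) ^ 2 := by gcongr
    _ = _ := Real.sq_sqrt hnn

/-- Integration of a gradient bound along the radii of the unit disk. -/
lemma norm_le_of_norm_fderiv_le {f : ℂ → ℂ} {K a : ℝ} (ha : 0 < a)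
    (hf : DifferentiableOn ℝ f (ball 0 1))
    (hD : ∀ z ∈ ball (0 : ℂ) 1, ‖fderiv ℝ f z‖ ≤ K * (1 - ‖z‖) ^ (-a - 1))
    {z : ℂ} (hz : z ∈ ball 0 1) :
    ‖f z‖ ≤ (‖f 0‖ + K / a) * (1 - ‖z‖) ^ (-a) := by
  have hK : 0 ≤ K := by
    have := (norm_nonneg _).trans (hD 0 (by simp))
    simpa using this
  rw [mem_ball_zero_iff] at hz
  have hpos : ∀ t ∈ Icc (0 : ℝ) 1, 0 < 1 - t * ‖z‖ := by
    intro t ht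
    nlinarith [ht.1, ht.2, norm_nonneg z]
  have hmem : ∀ t ∈ Icc (0 : ℝ) 1, t • z ∈ ball (0 : ℂ) 1 := by
    intro t ht
    rw [mem_ball_zero_iff, norm_smul, Real.norm_of_nonneg ht.1]
    linarith [hpos t ht]
  have hd : ∀ t ∈ Icc (0 : ℝ) 1,
      HasDerivAt (fun t : ℝ => f (t • z)) (fderiv ℝ f (t • z) z) t := by
    intro t ht
    have h1 : HasDerivAt (fun t : ℝ => t • z) z t := by
      simpa using (hasDerivAt_id t).smul_const z
    exact (hf.differentiableAt (isOpen_ball.mem_nhds (hmem t ht))).hasFDerivAt.comp_hasDerivAt t h1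
  let B : ℝ → ℝ := fun t => ‖f 0‖ + K / a * (1 - t * ‖z‖) ^ (-a)
  have hB : ∀ t ∈ Icc (0 : ℝ) 1, HasDerivAt B (K * (1 - t * ‖z‖) ^ (-a - 1) * ‖z‖) t := by
    intro t ht
    have h1 : HasDerivAt (fun t : ℝ => 1 - t * ‖z‖) (-‖z‖) t := by
      simpa using ((hasDerivAt_id t).mul_const ‖z‖).const_sub 1
    refine (((h1.rpow_const (p := -a) (Or.inl (hpos t ht).ne')).const_mul (K / a)).const_add
      ‖f 0‖).congr_deriv ?_
    field_simp
  have := image_norm_le_of_norm_deriv_right_le_deriv_boundary' (a := 0) (b := 1)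
    (f := fun t : ℝ => f (t • z)) (f' := fun t => fderiv ℝ f (t • z) z)
    (B := B) (B' := fun t => K * (1 - t * ‖z‖) ^ (-a - 1) * ‖z‖)
    (fun t ht => (hd t ht).continuousAt.continuousWithinAt)
    (fun t ht => (hd t (Ico_subset_Icc_self ht)).hasDerivWithinAt)
    (by simp only [B, zero_smul, zero_mul, sub_zero, Real.one_rpow]
        linarith [div_nonneg hK ha.le])
    (fun t ht => (hB t ht).continuousAt.continuousWithinAt)
    (fun t ht => (hB t (Ico_subset_Icc_self ht)).hasDerivWithinAt)
    (fun t ht => by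
      have h1 := hD _ (hmem t (Ico_subset_Icc_self ht))
      rw [norm_smul, Real.norm_of_nonneg ht.1] at h1
      exact ((fderiv ℝ f (t • z)).le_opNorm z).trans (by gcongr))
    (right_mem_Icc.2 zero_le_one)
  simp only [B, one_smul, one_mul] at this
  have h1 : 1 ≤ (1 - ‖z‖) ^ (-a) :=
    Real.one_le_rpow_of_pos_of_le_one_of_nonpos (by linarith) (by linarith [norm_nonneg z])
      (by linarith)
  have := mul_le_mul_of_nonneg_left h1 (norm_nonneg (f 0))
  linarith

/-! ### The weighted Dirichlet integral -/

lemma DiskSpaces.one_sub_norm_le_bdist (z : ℂ) : 1 - ‖z‖ ≤ DiskSpaces.bdist z := by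
  rw [DiskSpaces.bdist, DiskSpaces.disk, frontier_ball 0 one_ne_zero]
  refine (le_infDist (NormedSpace.sphere_nonempty.2 zero_le_one)).2 fun y hy => ?_
  rw [mem_sphere_zero_iff_norm] at hy
  rw [dist_comm, dist_eq_norm, ← hy]
  exact norm_sub_norm_le y z

lemma DiskSpaces.MemDirichlet.integrableOn {f : ℂ → ℂ} {γ : ℝ} (hγ : 0 < γ)
    (hf : DiskSpaces.MemDirichlet γ 2 f) :
    IntegrableOn (fun z => (1 - ‖z‖) ^ γ * ‖fderiv ℝ f z‖ ^ 2) (ball 0 1) := by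
  have hDc : ContinuousOn (fderiv ℝ f) (ball 0 1) :=
    hf.contDiffOn.continuousOn_fderiv_of_isOpen isOpen_ball le_rfl
  have hc : ContinuousOn (fun z => (1 - ‖z‖) ^ γ * ‖fderiv ℝ f z‖ ^ 2) (ball 0 1) :=
    ((continuous_const.sub continuous_norm).rpow_const fun _ => Or.inr hγ.le).continuousOn.mul
      (hDc.norm.pow 2)
  refine ⟨hc.aestronglyMeasurable measurableSet_ball, ?_⟩
  have h1 := hf.norm_lt_top
  rw [DiskSpaces.dirichletNorm, ENNReal.add_lt_top, DiskSpaces.areaMeasure,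
    lintegral_smul_measure, smul_eq_mul] at h1
  have h2 : (volume DiskSpaces.disk)⁻¹ ≠ 0 :=
    ENNReal.inv_ne_zero.2 (measure_ball_lt_top (μ := volume)).ne
  refine lt_of_le_of_lt ?_ (ENNReal.lt_top_of_mul_ne_top_right h1.2.ne h2)
  refine setLIntegral_mono' measurableSet_ball fun z hz => ?_
  rw [mem_ball_zero_iff] at hz
  have hz' : 0 ≤ 1 - ‖z‖ := by linarith
  rw [Real.enorm_of_nonneg (by positivity), Real.rpow_two]
  show ENNReal.ofReal ((1 - ‖z‖) ^ γ * ‖fderiv ℝ f z‖ ^ 2) ≤ _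
  gcongr
  exact DiskSpaces.one_sub_norm_le_bdist z

/-! ### Boundedness of the integral means -/

/-- A solution of finite weighted energy is `O((1 - |z|)^(-γ/2))`. -/
lemma exists_norm_sq_add_one_le {f : ℂ → ℂ} {γ lam : ℝ} (hγ : 0 < γ) (hlam : 0 ≤ lam)
    (hf : ContDiffOn ℝ 2 f (ball 0 1))
    (hpde : ∀ z ∈ ball 0 1, Laplacian.laplacian f z = (lam : ℂ) * f z)
    (hint : IntegrableOn (fun z => (1 - ‖z‖) ^ γ * ‖fderiv ℝ f z‖ ^ 2) (ball 0 1)) :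
    ∃ C, 0 < C ∧ ∀ z ∈ ball 0 1, ‖f z‖ ^ 2 + 1 ≤ C * (1 - ‖z‖) ^ (-γ) := by
  -- `E` is the weighted energy; `K` comes from the gradient bound of order `-(2 + γ)` for `|Df|²`.
  set E := ∫ y in ball (0 : ℂ) 1, (1 - ‖y‖) ^ γ * ‖fderiv ℝ f y‖ ^ 2
  set K := √(E / π * (1 / 2) ^ (-(2 + γ)))
  have hD : ∀ z ∈ ball (0 : ℂ) 1, ‖fderiv ℝ f z‖ ≤ K * (1 - ‖z‖) ^ (-(γ / 2) - 1) := by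
    intro z hz
    have h := norm_fderiv_sq_le_of_integrableOn hγ hlam hf hpde hint hz
    rw [mem_ball_zero_iff] at hz
    have hd : 0 < 1 - ‖z‖ := by linarith
    have e : E / π * ((1 - ‖z‖) / 2) ^ (-(2 + γ)) =
        E / π * (1 / 2) ^ (-(2 + γ)) * ((1 - ‖z‖) ^ (-(γ / 2) - 1)) ^ 2 := by
      rw [← Real.rpow_mul_natCast hd.le, div_eq_mul_one_div (1 - ‖z‖),
        Real.mul_rpow hd.le (by norm_num)]
      push_cast
      ring_nf
    rw [e] at h
    have := Real.le_sqrt_of_sq_le h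
    rwa [Real.sqrt_mul' _ (by positivity), Real.sqrt_sq (by positivity)] at this
  refine ⟨(‖f 0‖ + K / (γ / 2)) ^ 2 + 1, by positivity, fun z hz => ?_⟩
  have h := norm_le_of_norm_fderiv_le (by positivity) (hf.differentiableOn two_ne_zero) hD hz
  rw [mem_ball_zero_iff] at hz
  have hd : 0 < 1 - ‖z‖ := by linarith
  have h1 : 1 ≤ (1 - ‖z‖) ^ (-γ) :=
    Real.one_le_rpow_of_pos_of_le_one_of_nonpos hd (by linarith [norm_nonneg z]) (by linarith)
  have h2 : ‖f z‖ ^ 2 ≤ (‖f 0‖ + K / (γ / 2)) ^ 2 * (1 - ‖z‖) ^ (-γ) := by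
    have e : (1 - ‖z‖) ^ (-γ) = ((1 - ‖z‖) ^ (-(γ / 2))) ^ 2 := by
      rw [← Real.rpow_mul_natCast hd.le]
      push_cast
      ring_nf
    rw [e, ← mul_pow]
    gcongr
  linarith

/-- Circle averages of the smooth majorant `(|f|² + 1)^(1/γ)` of `|f|^(2/γ)` are bounded: the
growth bound on `f` turns the weight `1 - |z|` of Green's identity into the weight
`(1 - |z|)^γ` of the energy. -/
lemma exists_circleAverage_rpow_le {f : ℂ → ℂ} {γ lam : ℝ} (hγ : 0 < γ) (hγ1 : γ ≤ 1)
    (hlam : 0 ≤ lam) (hf : ContDiffOn ℝ 2 f (ball 0 1))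
    (hpde : ∀ z ∈ ball 0 1, Laplacian.laplacian f z = (lam : ℂ) * f z)
    (hint : IntegrableOn (fun z => (1 - ‖z‖) ^ γ * ‖fderiv ℝ f z‖ ^ 2) (ball 0 1)) :
    ∃ C, ∀ r ∈ Ioo (0 : ℝ) 1, circleAverage (fun z => (‖f z‖ ^ 2 + 1) ^ (1 / γ)) 0 r ≤ C := by
  obtain ⟨C, hC, hw⟩ := exists_norm_sq_add_one_le hγ hlam hf hpde hint
  set q := 1 / γ with hq
  have hq1 : 1 ≤ q := by rw [hq, le_div_iff₀ hγ]; linarith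
  have hγq : γ * q = 1 := by rw [hq]; field_simp
  have hDc : ContinuousOn (fderiv ℝ f) (ball 0 1) :=
    hf.continuousOn_fderiv_of_isOpen isOpen_ball (by norm_num)
  let H : ℂ → ℝ := fun z => 8 * q ^ 2 * C ^ (q - 1) * ((1 - ‖z‖) ^ γ * ‖fderiv ℝ f z‖ ^ 2) +
    2 * q * lam * C ^ q
  have hHc : ContinuousOn H (ball 0 1) :=
    (continuousOn_const.mul
      (((continuous_const.sub continuous_norm).rpow_const fun _ => Or.inr hγ.le).continuousOn.mul
        (hDc.norm.pow 2))).add continuousOn_const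
  have hHi : IntegrableOn H (ball 0 1) :=
    (hint.const_mul _).add (integrableOn_const measure_ball_lt_top.ne)
  have hg : ContDiffOn ℝ 2 (fun z => (‖f z‖ ^ 2 + 1) ^ q) (ball 0 1) :=
    ((hf.norm_sq ℝ).add contDiffOn_const).rpow_const_of_ne fun y _ =>
      (by positivity : 0 < ‖f y‖ ^ 2 + 1).ne'
  refine exists_circleAverage_le_of_laplacian_le (H := H)
    (M := (2 * π)⁻¹ * ∫ z in ball 0 1, H z) hg
    (fun z hz => laplacian_rpow_norm_sq_add_one_nonneg hlam hq1 isOpen_ball hf hz (hpde z hz))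
    hHc (fun z hz => ?_) fun R hR => ?_
  · have h1 := laplacian_rpow_norm_sq_add_one_le hlam hq1 isOpen_ball hf hz (hpde z hz)
    have h2 := hw z hz
    rw [mem_ball_zero_iff] at hz
    have hd : 0 < 1 - ‖z‖ := by linarith
    -- The choice `q = 1/γ` makes the weights come out as `(1 - |z|)^(γ - 1)` and `(1 - |z|)^(-1)`.
    have h3 : (‖f z‖ ^ 2 + 1) ^ (q - 1) ≤ C ^ (q - 1) * (1 - ‖z‖) ^ (γ - 1) := by
      calc _ ≤ (C * (1 - ‖z‖) ^ (-γ)) ^ (q - 1) :=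
            Real.rpow_le_rpow (by positivity) h2 (by linarith)
        _ = _ := by
            rw [Real.mul_rpow hC.le (by positivity), ← Real.rpow_mul hd.le,
              show -γ * (q - 1) = γ - 1 by linarith]
    have h4 : (‖f z‖ ^ 2 + 1) ^ q ≤ C ^ q * (1 - ‖z‖) ^ (-1 : ℝ) := by
      calc _ ≤ (C * (1 - ‖z‖) ^ (-γ)) ^ q :=
            Real.rpow_le_rpow (by positivity) h2 (by linarith)
        _ = _ := by
            rw [Real.mul_rpow hC.le (by positivity), ← Real.rpow_mul hd.le,
              show -γ * q = -1 by linarith]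
    calc _ ≤ (1 - ‖z‖) * (8 * q ^ 2 * (C ^ (q - 1) * (1 - ‖z‖) ^ (γ - 1)) *
          ‖fderiv ℝ f z‖ ^ 2 + 2 * q * lam * (C ^ q * (1 - ‖z‖) ^ (-1 : ℝ))) := by
          refine mul_le_mul_of_nonneg_left (h1.trans ?_) hd.le
          gcongr
      _ = H z := by
          simp only [H]
          rw [Real.rpow_neg_one, Real.rpow_sub_one hd.ne']
          field_simp
  · have hsub : closedBall (0 : ℂ) R ⊆ ball 0 1 := closedBall_subset_ball hR.2
    have h1 := setIntegral_closedBall_eq_integral_circleAverage hR.1.le (hHc.mono hsub)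
    have h2 : ∫ z in closedBall 0 R, H z ≤ ∫ z in ball 0 1, H z := by
      refine setIntegral_mono_set hHi ?_ hsub.eventuallyLE
      refine (ae_restrict_mem measurableSet_ball).mono fun y hy => ?_
      rw [mem_ball_zero_iff] at hy
      have : 0 ≤ 1 - ‖y‖ := by linarith
      simp only [Pi.zero_apply, H]
      positivity
    rw [le_inv_mul_iff₀ (by positivity), ← h1]
    exact h2

theorem mainTheorem9 (γ : ℝ) (hγ0 : 0 < γ) (hγ1 : γ ≤ 1) (lam : ℝ) (hlam : 0 ≤ lam)
    (f : ℂ → ℂ) (hf : ContDiffOn ℝ 2 f DiskSpaces.disk)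
    (hfD : DiskSpaces.MemDirichlet γ 2 f)
    (hpde : ∀ z ∈ DiskSpaces.disk, Laplacian.laplacian f z = (lam : ℂ) * f z) :
    DiskSpaces.MemHardy (ENNReal.ofReal (2 / γ)) f := by
  have hp : (ENNReal.ofReal (2 / γ)).toReal = 2 / γ := ENNReal.toReal_ofReal (by positivity)
  have hf' : ContDiffOn ℝ 2 f (ball 0 1) := hf
  have hc : ContinuousOn (fun z => ‖f z‖ ^ (2 / γ)) (ball 0 1) :=
    hf'.continuousOn.norm.rpow_const fun _ _ => Or.inr (by positivity)
  have habs : ∀ r ∈ Ioo (0 : ℝ) 1, |r| < 1 := fun r hr => by rw [abs_of_pos hr.1]; exact hr.2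
  refine ⟨(continuousOn_iff_continuous_domRestrict.1 hf.continuousOn).measurable,
    fun _ r hr => ?_, ?_⟩
  · rw [hp]
    exact hc.circleIntegrable_of_lt (habs r hr)
  · obtain ⟨C, hC⟩ := exists_circleAverage_rpow_le hγ0 hγ1 hlam hf' hpde (hfD.integrableOn hγ0)
    rw [DiskSpaces.hardyNorm, if_neg ENNReal.ofReal_ne_top, hp]
    refine lt_of_le_of_lt (iSup₂_le fun r hr => ENNReal.ofReal_le_ofReal ?_)
      (ENNReal.ofReal_lt_top (r := C ^ (1 / (2 / γ))))
    have hle : circleAverage (fun z => ‖f z‖ ^ (2 / γ)) 0 r ≤ C := by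
      refine le_trans (circleAverage_mono (hc.circleIntegrable_of_lt (habs r hr)) ?_ ?_) (hC r hr)
      · refine ContinuousOn.circleIntegrable_of_lt (R := 1) ?_ (habs r hr)
        exact ((hf'.continuousOn.norm.pow 2).add continuousOn_const).rpow_const
          fun _ _ => Or.inr (by positivity)
      · intro z _
        have e : ‖f z‖ ^ (2 / γ) = (‖f z‖ ^ 2) ^ (1 / γ) := by
          rw [← Real.rpow_natCast_mul (norm_nonneg _)]
          push_cast
          ring_nf
        simp only [e]
        gcongr
        linarith
    exact Real.rpow_le_rpow (circleAverage_nonneg_of_forall_ball (R := 1)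
      (fun z _ => by positivity) (habs r hr)) hle (by positivity)
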